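/- For $A\subset\mathbb{R}^n$ let $\rho(A)=\sum_{x\in A}e^{-\pi\|x\|^2}$, where $\|\cdot\|$ is the Euclidean norm. For a lattice $\mathcal{L}\subset\mathbb{R}^n$ (the set of all integer linear combinations of some linearly independent vectors; its rank may be less than $n$), let $$f(t)=\frac{\rho(\mathcal{L}+t)}{\rho(\mathcal{L})},\qquad t\in\mathbb{R}^n,$$ be its periodic Gaussian function. Let $\varepsilon\in(0,1/200)$ and suppose that $\rho(\mathcal{L})=1+\varepsilon$. Put $$s_\varepsilon=\Big(\frac1\pi\log\frac{2(1+\varepsilon)}{\varepsilon}\Big)^{1/2},\qquad \delta_{\max}=\frac12-\frac{2}{\pi s_\varepsilon^2},\qquad \delta(t)=\max\Big(\frac18,\frac{\|t\|}{s_\varepsilon}\Big).$$ Then $f$ is positive and differentiable on $\mathbb{R}^n$, and for all $t\in\mathbb{R}^n$ with $\|t\|<s_\varepsilon/2$, $$\Big\|\frac{\nabla f(t)}{2\pi f(t)}+t\Big\|\le 12\,(\varepsilon/2)^{1-2\delta(t)}\,\|t\|.$$ In particular, for all $t\in\mathbb{R}^n$ with $\delta(t)\le\delta_{\max}$, $$\Big\|\frac{\nabla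 f(t)}{2\pi f(t)}+t\Big\|\le\frac{\|t\|}{4}.$$ -/

import Mathlib

namespace PeriodicGaussian

/-- The Gaussian weight `ρ(x) = exp (-π ‖x‖²)` on `ℝⁿ` (with the Euclidean norm). -/
noncomputable def rho {n : ℕ} (x : EuclideanSpace ℝ (Fin n)) : ℝ :=
  Real.exp (-Real.pi * ‖x‖ ^ 2)

/-- The Gaussian mass `ρ(A) = ∑_{x ∈ A} ρ(x)` of a set `A ⊆ ℝⁿ`. -/
noncomputable def rhoSet {n : ℕ} (A : Set (EuclideanSpace ℝ (Fin n))) : ℝ :=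
  ∑' x : A, rho (x : EuclideanSpace ℝ (Fin n))

/-- The periodic Gaussian function `f(t) = ρ(L + t) / ρ(L)`, where `L + t = {y + t | y ∈ L}`. -/
noncomputable def periodicGaussian {n : ℕ} (L : Submodule ℤ (EuclideanSpace ℝ (Fin n)))
    (t : EuclideanSpace ℝ (Fin n)) : ℝ :=
  rhoSet ((fun y => y + t) '' (L : Set (EuclideanSpace ℝ (Fin n)))) /
    rhoSet (L : Set (EuclideanSpace ℝ (Fin n)))

/-- `s_ε = ((1/π) log (2(1+ε)/ε))^{1/2}`. -/
noncomputable def sEps (ε : ℝ) : ℝ :=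
  Real.sqrt (1 / Real.pi * Real.log (2 * (1 + ε) / ε))

/-- `δ_max = 1/2 - 2/(π s_ε²)`. -/
noncomputable def deltaMax (ε : ℝ) : ℝ :=
  1 / 2 - 2 / (Real.pi * sEps ε ^ 2)

/-- `δ(t) = max (1/8) (‖t‖ / s_ε)`. -/
noncomputable def delta {n : ℕ} (ε : ℝ) (t : EuclideanSpace ℝ (Fin n)) : ℝ :=
  max (1 / 8) (‖t‖ / sEps ε)

/-- The vector `∇f(t) / (2π f(t)) + t`, with `f` the periodic Gaussian function of `L`. -/
noncomputable def gradError {n : ℕ} (L : Submodule ℤ (EuclideanSpace ℝ (Fin n)))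
    (t : EuclideanSpace ℝ (Fin n)) : EuclideanSpace ℝ (Fin n) :=
  (2 * Real.pi * periodicGaussian L t)⁻¹ • gradient (periodicGaussian L) t + t

end PeriodicGaussian

/-! ### Autocorrelation along a subgroup. -/

open MeasureTheory ENNReal

/-! Pairing `y` with `-y` gives `⟪∇f/(2πf) + t, u⟫ = ∑ ρ(y) sinh(2π⟪y,t⟫)⟪y,u⟫ / ∑ ρ(y)
cosh(2π⟪y,t⟫)` (`inner_gradError`). The denominator is at least `ρ(L) = 1 + ε`, and only `y ≠ 0`, of
total mass `ε`, enter the numerator.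

The one global input is `ρ(L + t) ≤ ρ(L)` (`tsum_gaussian_translate_le`), proved without Fourier
analysis: up to a constant, `ρ(L + t)` is the correlation of a narrower Gaussian with the translate
by `t` of its periodization. At `t = s • u` it bounds the exponential moments of `|⟪y,u⟫|` over `y ≠
0` by `ε e^{2Λ}`, where `Λ = πs²` and `s = s_ε`.

`mul_exp_le_interpolation` then bounds `|⟪y,u⟫| e^{2πδs|⟪y,t/‖t‖⟫|}` by a convex combination of `1`
and two such exponentials, each normalized by `e^{-2Λ}`, so the numerator is `O(‖t‖ e^{2δΛ} ε)`.
Since `e^Λ = 2(1+ε)/ε`, this has order `(ε/2)^{1-2δ} ‖t‖`. -/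

theorem ENNReal.two_mul_mul_le_add_sq (a b : ℝ≥0∞) : 2 * (a * b) ≤ a ^ 2 + b ^ 2 := by
  rcases le_total a b with h | h
  · obtain ⟨c, rfl⟩ := exists_add_of_le h
    calc 2 * (a * (a + c)) ≤ 2 * (a * (a + c)) + c ^ 2 := le_self_add
      _ = a ^ 2 + (a + c) ^ 2 := by ring
  · obtain ⟨c, rfl⟩ := exists_add_of_le h
    calc 2 * ((b + c) * b) ≤ 2 * ((b + c) * b) + c ^ 2 := le_self_add
      _ = (b + c) ^ 2 + b ^ 2 := by ring

/-- The autocorrelation of a function along the translates by a subgroup, summed over the subgroup,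
is largest at the origin. -/
theorem lintegral_mul_tsum_translate_le {V : Type*} [AddCommGroup V] [MeasurableSpace V]
    [MeasurableAdd V] (μ : Measure V) [μ.IsAddRightInvariant] (L : AddSubgroup V) [Countable L]
    {h : V → ℝ≥0∞} (hm : Measurable h) (h0 : ∀ w, ∑' y : L, h (w + y) ≠ 0)
    (htop : ∀ w, ∑' y : L, h (w + y) ≠ ⊤) (t : V) :
    ∫⁻ w, h w * ∑' y : L, h (w + t + y) ∂μ ≤ ∫⁻ w, h w * ∑' y : L, h (w + y) ∂μ := by
  set H : V → ℝ≥0∞ := fun w => ∑' y : L, h (w + y) with hH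
  have hHm : Measurable H := Measurable.tsum fun y => hm.comp (measurable_add_const _)
  have hHper : ∀ (w : V) (y : L), H (w + y) = H w := fun w y => by
    simp only [hH]
    rw [← (Equiv.addLeft y).tsum_eq (fun z : L => h (w + z))]
    simp [add_assoc]
  have hsub : ∀ w, ∑' y : L, h (w - y) = H w := fun w => by
    simp only [hH]
    rw [← (Equiv.neg L).tsum_eq (fun z : L => h (w + z))]
    simp [sub_eq_add_neg]
  have hHt : Measurable fun w => H (w + t) := hHm.comp (measurable_add_const _)
  -- Unfold one factor `H (w + t)` and shift each term by its `y`: since `H` is periodic, the sum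
  -- moves onto `h w`, producing an `H w` that cancels the inverse. No quotient by `L` is needed, so
  -- the rank is arbitrary.
  have key : ∫⁻ w, h w * (H w)⁻¹ * H (w + t) ^ 2 ∂μ = ∫⁻ w, h w * H w ∂μ := by
    calc ∫⁻ w, h w * (H w)⁻¹ * H (w + t) ^ 2 ∂μ
        = ∫⁻ w, ∑' y : L, h w * (H w)⁻¹ * H (w + t) * h (w + y + t) ∂μ := by
          refine lintegral_congr fun w => ?_
          rw [ENNReal.tsum_mul_left, sq, ← mul_assoc]
          simp only [hH, add_right_comm]
      _ = ∑' y : L, ∫⁻ w, h w * (H w)⁻¹ * H (w + t) * h (w + y + t) ∂μ := by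
          refine lintegral_tsum fun y => Measurable.aemeasurable ?_
          have : Measurable fun w => h (w + y + t) := by
            simp only [add_assoc]; exact hm.comp (measurable_add_const _)
          exact ((hm.mul hHm.inv).mul hHt).mul this
      _ = ∑' y : L, ∫⁻ w, h (w - y) * ((H w)⁻¹ * H (w + t) * h (w + t)) ∂μ := by
          refine tsum_congr fun y => ?_
          rw [← lintegral_add_right_eq_self _ (-(y : V))]
          refine lintegral_congr fun w => ?_
          have e1 : H (w + -(y : V)) = H w := by simpa using hHper w (-y)
          have e2 : H (w + -(y : V) + t) = H (w + t) := by
            rw [add_right_comm]; simpa using hHper (w + t) (-y)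
          rw [e1, e2, neg_add_cancel_right, sub_eq_add_neg]
          ring
      _ = ∫⁻ w, ∑' y : L, h (w - y) * ((H w)⁻¹ * H (w + t) * h (w + t)) ∂μ := by
          refine (lintegral_tsum fun y => Measurable.aemeasurable ?_).symm
          have : Measurable fun w => h (w - y) := by
            simp only [sub_eq_add_neg]; exact hm.comp (measurable_add_const _)
          exact this.mul ((hHm.inv.mul hHt).mul (hm.comp (measurable_add_const _)))
      _ = ∫⁻ w, h (w + t) * H (w + t) ∂μ := by
          refine lintegral_congr fun w => ?_
          rw [ENNReal.tsum_mul_right, hsub, mul_assoc, ← mul_assoc,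
            ENNReal.mul_inv_cancel (h0 w) (htop w), one_mul, mul_comm]
      _ = ∫⁻ w, h w * H w ∂μ := lintegral_add_right_eq_self (fun w => h w * H w) t
  have hle : 2 * ∫⁻ w, h w * H (w + t) ∂μ ≤ 2 * ∫⁻ w, h w * H w ∂μ := by
    calc 2 * ∫⁻ w, h w * H (w + t) ∂μ = ∫⁻ w, 2 * (h w * H (w + t)) ∂μ :=
          (lintegral_const_mul _ (hm.mul hHt)).symm
      -- AM-GM for `H w` and `H (w + t)`, weighted by `h / H`; both resulting terms have the same
      -- integral by `key`.
      _ ≤ ∫⁻ w, (h w * H w + h w * (H w)⁻¹ * H (w + t) ^ 2) ∂μ := by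
          refine lintegral_mono fun w => ?_
          have hc := ENNReal.mul_inv_cancel (h0 w) (htop w)
          calc 2 * (h w * H (w + t)) = h w * (H w)⁻¹ * (2 * (H w * H (w + t))) := by
                calc _ = 2 * (h w * H (w + t)) * (H w * (H w)⁻¹) := by rw [hc, mul_one]
                  _ = _ := by ring
            _ ≤ h w * (H w)⁻¹ * (H w ^ 2 + H (w + t) ^ 2) := by
                gcongr; exact ENNReal.two_mul_mul_le_add_sq _ _
            _ = h w * H w * (H w * (H w)⁻¹) + h w * (H w)⁻¹ * H (w + t) ^ 2 := by ring
            _ = _ := by rw [hc, mul_one]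
      _ = 2 * ∫⁻ w, h w * H w ∂μ := by
          rw [lintegral_add_left (show Measurable fun w => h w * H w from hm.mul hHm), key, two_mul]
  exact (ENNReal.mul_le_mul_iff_right two_ne_zero ofNat_ne_top).1 hle

/-! ### Gaussian mass of a lattice and of its translates. -/

section Gaussian

variable {V : Type*} [NormedAddCommGroup V] [InnerProductSpace ℝ V] [FiniteDimensional ℝ V]

theorem summable_exp_neg_sq_add_linear (L : Submodule ℤ V) [DiscreteTopology L] (A : ℝ) :
    Summable fun y : L => Real.exp (-Real.pi * ‖(y : V)‖ ^ 2 + A * ‖(y : V)‖) := by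
  set N := Module.finrank ℤ L + 1
  have hs := (ZLattice.summable_norm_rpow L (-(N : ℝ)) (by simp [N])).mul_left
    (Real.exp ((A + 1) ^ 2) * N.factorial)
  refine Summable.of_norm_bounded_eventually hs ?_
  -- The comparison fails only at `y = 0`, where the majorant is `0 ^ (-N) = 0`.
  refine (Set.finite_singleton (0 : L)).subset fun y hy => ?_
  by_contra hne
  apply hy
  have hr : 0 < ‖(y : V)‖ := by simpa using hne
  simp only [Submodule.norm_coe] at hr ⊢
  set r := ‖y‖
  change ‖_‖ ≤ _
  rw [Real.norm_eq_abs, Real.abs_exp, Real.rpow_neg hr.le, Real.rpow_natCast]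
  have h1 := Real.pow_div_factorial_le_exp r hr.le N
  have h2 : Real.exp (-Real.pi * r ^ 2 + A * r) ≤ Real.exp ((A + 1) ^ 2) * Real.exp (-r) := by
    rw [← Real.exp_add, Real.exp_le_exp]
    nlinarith [Real.pi_gt_three, sq_nonneg (r - (A + 1)), sq_nonneg r, sq_nonneg (A + 1)]
  refine h2.trans ?_
  rw [mul_assoc]
  gcongr
  rw [Real.exp_neg, inv_le_comm₀ (Real.exp_pos _) (by positivity), mul_inv, inv_inv]
  calc _ = r ^ N / N.factorial := by ring
    _ ≤ _ := h1

theorem summable_exp_neg_norm_add_sq (L : Submodule ℤ V) [DiscreteTopology L] (t : V) :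
    Summable fun y : L => Real.exp (-Real.pi * ‖(y : V) + t‖ ^ 2) := by
  refine Summable.of_nonneg_of_le (fun _ => (Real.exp_pos _).le) (fun y => ?_)
    (summable_exp_neg_sq_add_linear L (2 * Real.pi * ‖t‖))
  rw [Real.exp_le_exp, norm_add_sq_real]
  have := neg_le_of_abs_le (abs_real_inner_le_norm (y : V) t)
  nlinarith [Real.pi_pos, sq_nonneg ‖t‖, mul_nonneg Real.pi_pos.le (sq_nonneg ‖t‖),
    mul_le_mul_of_nonneg_left this Real.pi_pos.le]

variable [MeasurableSpace V] [BorelSpace V]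

theorem lintegral_gaussian_lt_top {b : ℝ} (hb : 0 < b) :
    ∫⁻ w : V, ENNReal.ofReal (Real.exp (-b * ‖w‖ ^ 2)) < ⊤ := by
  have h := GaussianFourier.integrable_cexp_neg_mul_sq_norm_add (V := V) (b := b)
    (by simpa using hb) 0 0
  have h2 : Integrable fun w : V => Real.exp (-b * ‖w‖ ^ 2) := by
    convert! h.norm using 2 with w
    rw [Complex.norm_exp]
    congr 1
    simp [← Complex.ofReal_pow]
  exact h2.lintegral_lt_top

/-- Completing the square: `2‖w‖² + 2‖w + a‖² = 4‖w + a/2‖² + ‖a‖²`. -/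
theorem lintegral_gaussian_mul_translate (a : V) :
    ∫⁻ w : V, ENNReal.ofReal (Real.exp (-(2 * Real.pi) * ‖w‖ ^ 2)) *
        ENNReal.ofReal (Real.exp (-(2 * Real.pi) * ‖w + a‖ ^ 2)) =
      ENNReal.ofReal (Real.exp (-Real.pi * ‖a‖ ^ 2)) *
        ∫⁻ w : V, ENNReal.ofReal (Real.exp (-(4 * Real.pi) * ‖w‖ ^ 2)) := by
  rw [← lintegral_add_right_eq_self
    (fun w : V => ENNReal.ofReal (Real.exp (-(4 * Real.pi) * ‖w‖ ^ 2))) ((1 / 2 : ℝ) • a),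
    ← lintegral_const_mul _ (by fun_prop)]
  refine lintegral_congr fun w => ?_
  rw [← ENNReal.ofReal_mul (Real.exp_pos _).le, ← ENNReal.ofReal_mul (Real.exp_pos _).le,
    ← Real.exp_add, ← Real.exp_add, norm_add_sq_real, norm_add_sq_real, inner_smul_right, norm_smul]
  congr 2
  norm_num
  ring

theorem tsum_gaussian_translate_le (L : Submodule ℤ V) [DiscreteTopology L] (t : V) :
    ∑' y : L, Real.exp (-Real.pi * ‖(y : V) + t‖ ^ 2) ≤
      ∑' y : L, Real.exp (-Real.pi * ‖(y : V)‖ ^ 2) := by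
  have : Countable L := TopologicalSpace.separableSpace_iff_countable.1 inferInstance
  have : Countable L.toAddSubgroup := this
  set h : V → ℝ≥0∞ := fun w => ENNReal.ofReal (Real.exp (-(2 * Real.pi) * ‖w‖ ^ 2)) with hh
  have hm : Measurable h := by fun_prop
  have h0 : ∀ w, ∑' y : L.toAddSubgroup, h (w + y) ≠ 0 := fun w hw => by
    have := ENNReal.tsum_eq_zero.1 hw 0
    simp only [hh, ENNReal.ofReal_eq_zero] at this
    exact (Real.exp_pos _).not_ge this
  have htop : ∀ w, ∑' y : L.toAddSubgroup, h (w + y) ≠ ⊤ := fun w => by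
    refine ne_top_of_le_ne_top (summable_exp_neg_norm_add_sq L w).tsum_ofReal_ne_top
      (ENNReal.tsum_le_tsum fun y => ENNReal.ofReal_le_ofReal (Real.exp_le_exp.2 ?_))
    rw [add_comm]
    nlinarith [Real.pi_pos, mul_nonneg Real.pi_pos.le (sq_nonneg ‖(y : V) + w‖)]
  have main := lintegral_mul_tsum_translate_le volume L.toAddSubgroup hm h0 htop t
  set C := ∫⁻ w : V, ENNReal.ofReal (Real.exp (-(4 * Real.pi) * ‖w‖ ^ 2)) with hC
  have hCtop : C ≠ ⊤ := (lintegral_gaussian_lt_top (by positivity)).ne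
  have hC0 : C ≠ 0 := by
    rw [hC, Ne, lintegral_eq_zero_iff (by fun_prop)]
    intro hz
    have : (fun _ : V => False) =ᵐ[volume] fun _ => True := by
      filter_upwards [hz] with w hw
      simp only [Pi.zero_apply, ENNReal.ofReal_eq_zero] at hw
      exact ((Real.exp_pos _).not_ge hw).elim
    simp at this
  have conv : ∀ s : V, ∫⁻ w, h w * ∑' y : L.toAddSubgroup, h (w + s + y) =
      ENNReal.ofReal (∑' y : L, Real.exp (-Real.pi * ‖(y : V) + s‖ ^ 2)) * C := fun s => by
    rw [ENNReal.ofReal_tsum_of_nonneg (fun _ => (Real.exp_pos _).le)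
      (summable_exp_neg_norm_add_sq L s), ← ENNReal.tsum_mul_right]
    simp_rw [← ENNReal.tsum_mul_left]
    rw [lintegral_tsum fun y => by fun_prop]
    refine tsum_congr fun y => ?_
    rw [← lintegral_gaussian_mul_translate]
    simp only [hh, add_assoc, add_comm s]
  have c0 := conv 0
  simp only [add_zero] at c0
  rw [conv, c0, ENNReal.mul_le_mul_iff_left hC0 hCtop] at main
  exact (ENNReal.ofReal_le_ofReal_iff (tsum_nonneg fun _ => (Real.exp_pos _).le)).1 main

end Gaussian

/-! ### Scalar inequalities. -/

theorem Real.sinh_mul_le {l x : ℝ} (hl0 : 0 ≤ l) (hl1 : l ≤ 1) (hx : 0 ≤ x) :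
    Real.sinh (l * x) ≤ l * Real.sinh x := by
  have hd : ∀ z, HasDerivAt (fun z => l * Real.sinh z - Real.sinh (l * z))
      (l * Real.cosh z - Real.cosh (l * z) * l) z := fun z => by
    have := ((hasDerivAt_id z).const_mul l).sinh
    simp only [id, mul_one] at this
    exact ((Real.hasDerivAt_sinh z).const_mul l).sub this
  have hmono : MonotoneOn (fun z => l * Real.sinh z - Real.sinh (l * z)) (Set.Ici 0) := by
    refine monotoneOn_of_deriv_nonneg (convex_Ici 0)
      (fun z _ => (hd z).continuousAt.continuousWithinAt)
      (fun z _ => (hd z).differentiableAt.differentiableWithinAt) fun z hz => ?_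
    rw [interior_Ici] at hz
    have hz0 : 0 ≤ z := le_of_lt hz
    rw [(hd z).deriv, mul_comm, ← sub_mul]
    refine mul_nonneg (sub_nonneg.2 (Real.cosh_le_cosh.2 ?_)) hl0
    rw [abs_of_nonneg hz0, abs_of_nonneg (by positivity)]
    nlinarith
  have := hmono Set.self_mem_Ici hx hx
  simp at this
  linarith

/-- The factor `w` is affine in the exponent `a` below, so a tangent line bounds it by an
exponential; convexity of `exp` then splits the products. Once the terms `e^a`, `e^b` average to at
most `1`, the large bracket averages to at most `1`. -/
theorem mul_exp_le_interpolation {s δ w v : ℝ} (hs : 1 ≤ Real.pi * s ^ 2) (hs0 : 0 < s)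
    (hδ0 : 0 ≤ δ) (hδ : δ ≤ 1 / 2) :
    w * Real.exp (2 * Real.pi * (δ * s) * v) ≤
      s * Real.exp (2 * δ * (Real.pi * s ^ 2)) *
        ((1 - (2 * (Real.pi * s ^ 2) * (1 - δ))⁻¹) *
            (1 - δ + δ * Real.exp (2 * Real.pi * s * v - 2 * (Real.pi * s ^ 2))) +
          (2 * (Real.pi * s ^ 2) * (1 - δ))⁻¹ *
            ((1 - δ) * Real.exp (2 * Real.pi * s * w - 2 * (Real.pi * s ^ 2)) +
              δ * Real.exp (2 * Real.pi * s * v - 2 * (Real.pi * s ^ 2)))) := by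
  set κ := 2 * (Real.pi * s ^ 2) * (1 - δ) with hκ
  set a := 2 * Real.pi * s * w - 2 * (Real.pi * s ^ 2) with ha
  set b := 2 * Real.pi * s * v - 2 * (Real.pi * s ^ 2) with hb
  -- This makes `κ⁻¹` and `1 - κ⁻¹` legitimate convex weights.
  have hκ1 : 1 ≤ κ := by nlinarith
  have hκ0 : 0 < κ := by linarith
  have hi : κ⁻¹ ≤ 1 := inv_le_one_of_one_le₀ hκ1
  have cvx := fun x y : ℝ => convexOn_exp.2 (Set.mem_univ x) (Set.mem_univ y)
    (sub_nonneg.2 (by linarith : δ ≤ 1)) hδ0 (by ring)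
  have h1 : Real.exp (δ * b) ≤ 1 - δ + δ * Real.exp b := by simpa using cvx 0 b
  have h2 : Real.exp ((1 - δ) * a) * Real.exp (δ * b) ≤
      (1 - δ) * Real.exp a + δ * Real.exp b := by
    rw [← Real.exp_add]; simpa using cvx a b
  have hw : w ≤ s * (1 - κ⁻¹ + κ⁻¹ * Real.exp ((1 - δ) * a)) := by
    have hexp := Real.add_one_le_exp ((1 - δ) * a)
    have : w = s * (1 + κ⁻¹ * ((1 - δ) * a)) := by
      have : s ≠ 0 := hs0.ne'
      have : 1 - δ ≠ 0 := by linarith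
      have := Real.pi_ne_zero
      rw [hκ, ha]; field_simp; ring
    have h3 : κ⁻¹ * ((1 - δ) * a) ≤ κ⁻¹ * (Real.exp ((1 - δ) * a) - 1) := by
      gcongr; linarith
    rw [this]
    refine mul_le_mul_of_nonneg_left ?_ hs0.le
    linarith
  have hsplit : Real.exp (2 * Real.pi * (δ * s) * v) =
      Real.exp (2 * δ * (Real.pi * s ^ 2)) * Real.exp (δ * b) := by
    rw [← Real.exp_add]; congr 1; rw [hb]; ring
  calc w * Real.exp (2 * Real.pi * (δ * s) * v)
      ≤ s * (1 - κ⁻¹ + κ⁻¹ * Real.exp ((1 - δ) * a)) *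
        (Real.exp (2 * δ * (Real.pi * s ^ 2)) * Real.exp (δ * b)) := by rw [hsplit]; gcongr
    _ = s * Real.exp (2 * δ * (Real.pi * s ^ 2)) * ((1 - κ⁻¹) * Real.exp (δ * b) +
        κ⁻¹ * (Real.exp ((1 - δ) * a) * Real.exp (δ * b))) := by ring
    _ ≤ _ := by
        have := sub_nonneg.2 hi
        gcongr

/-! ### Gaussian sums: derivative, even and odd parts, exponential moments. -/

section GaussianSums

variable {V : Type*} [NormedAddCommGroup V] [InnerProductSpace ℝ V]

/-- A majorant uniform in `x` on a ball, for termwise differentiation. -/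
theorem exp_neg_norm_add_sq_mul_norm_le {R : ℝ} {x : V} (hx : ‖x‖ ≤ R) (y : V) :
    Real.exp (-Real.pi * ‖y + x‖ ^ 2) * ‖y + x‖ ≤
      Real.exp R * Real.exp (-Real.pi * ‖y‖ ^ 2 + (2 * Real.pi * R + 1) * ‖y‖) := by
  have h1 : ‖y + x‖ ≤ Real.exp (‖y‖ + R) :=
    (norm_add_le y x).trans (by linarith [Real.add_one_le_exp (‖y‖ + R)])
  have hin : -(‖y‖ * R) ≤ inner ℝ y x :=
    (neg_le_neg (mul_le_mul_of_nonneg_left hx (norm_nonneg y))).trans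
      (neg_le_of_abs_le (abs_real_inner_le_norm y x))
  calc _ ≤ Real.exp (-Real.pi * ‖y + x‖ ^ 2) * Real.exp (‖y‖ + R) := by gcongr
    _ ≤ _ := by
      rw [← Real.exp_add, ← Real.exp_add, Real.exp_le_exp, norm_add_sq_real]
      nlinarith [Real.pi_pos, mul_nonneg Real.pi_pos.le (sq_nonneg ‖x‖),
        mul_le_mul_of_nonneg_left hin Real.pi_pos.le]

theorem exp_neg_norm_add_sq (y t : V) :
    Real.exp (-Real.pi * ‖y + t‖ ^ 2) = Real.exp (-Real.pi * ‖t‖ ^ 2) *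
      (Real.exp (-Real.pi * ‖y‖ ^ 2) * Real.exp (-(2 * Real.pi * inner ℝ y t))) := by
  rw [← Real.exp_add, ← Real.exp_add, norm_add_sq_real]
  congr 1
  ring

/-- `Real.sinh_mul_le` with ratio `‖t‖ / (δ s) ≤ 1` extracts the factor `‖t‖` and leaves an
exponential of fixed rate `2πδs`. -/
theorem sinh_mul_inner_le {s δ : ℝ} (hs0 : 0 < s) (hδ : 0 < δ) {t u y : V} (ht0 : t ≠ 0)
    (ht : ‖t‖ ≤ δ * s) :
    Real.sinh (2 * Real.pi * inner ℝ y t) * inner ℝ y u ≤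
      ‖t‖ / (2 * δ * s) *
        (|inner ℝ y u| * Real.exp (2 * Real.pi * (δ * s) * |inner ℝ y (‖t‖⁻¹ • t)|)) := by
  have htn : 0 < ‖t‖ := norm_pos_iff.2 ht0
  have hm : 0 < δ * s := by positivity
  set v := |inner ℝ y (‖t‖⁻¹ • t)| with hv
  have hv0 : 0 ≤ v := abs_nonneg _
  have habs : |2 * Real.pi * inner ℝ y t| = ‖t‖ / (δ * s) * (2 * Real.pi * (δ * s) * v) := by
    rw [hv, inner_smul_right, abs_mul (2 * Real.pi), abs_mul ‖t‖⁻¹,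
      abs_of_pos (by positivity : 0 < 2 * Real.pi),
      abs_of_pos (by positivity : 0 < ‖t‖⁻¹)]
    field_simp
  have h1 : |Real.sinh (2 * Real.pi * inner ℝ y t)| ≤
      ‖t‖ / (δ * s) * (Real.exp (2 * Real.pi * (δ * s) * v) / 2) := by
    rw [Real.abs_sinh, habs]
    refine (Real.sinh_mul_le (by positivity) ((div_le_one hm).2 ht) (by positivity)).trans ?_
    gcongr
    rw [Real.sinh_eq]
    have := Real.exp_pos (-(2 * Real.pi * (δ * s) * v))
    linarith
  calc _ ≤ |Real.sinh (2 * Real.pi * inner ℝ y t)| * |inner ℝ y u| := by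
        rw [← abs_mul]; exact le_abs_self _
    _ ≤ ‖t‖ / (δ * s) * (Real.exp (2 * Real.pi * (δ * s) * v) / 2) * |inner ℝ y u| := by gcongr
    _ = _ := by field_simp

variable [FiniteDimensional ℝ V] (L : Submodule ℤ V) [DiscreteTopology L]

theorem hasFDerivAt_tsum_gaussian (t : V) :
    HasFDerivAt (fun x => ∑' y : L, Real.exp (-Real.pi * ‖(y : V) + x‖ ^ 2))
      (∑' y : L, (Real.exp (-Real.pi * ‖(y : V) + t‖ ^ 2) * (-(2 * Real.pi))) •
        innerSL ℝ ((y : V) + t)) t := by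
  have hu := ((summable_exp_neg_sq_add_linear L (2 * Real.pi * (‖t‖ + 1) + 1)).mul_left
    (Real.exp (‖t‖ + 1))).mul_left (2 * Real.pi)
  refine hasFDerivAt_tsum_of_isPreconnected (s := Metric.ball 0 (‖t‖ + 1)) (x₀ := t)
    (f' := fun (y : L) x => (Real.exp (-Real.pi * ‖(y : V) + x‖ ^ 2) * (-(2 * Real.pi))) •
        innerSL ℝ ((y : V) + x)) hu
    Metric.isOpen_ball (convex_ball _ _).isPreconnected (fun y x _ => ?_) (fun y x hx => ?_)
    (by simp) (summable_exp_neg_norm_add_sq L t) (by simp)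
  · have h1 : HasFDerivAt (fun x => (y : V) + x) (ContinuousLinearMap.id ℝ V) x :=
      (hasFDerivAt_id x).const_add _
    have h2 := (((hasStrictFDerivAt_norm_sq ((y : V) + x)).hasFDerivAt.comp x h1).const_mul
      (-Real.pi)).exp
    refine h2.congr_fderiv ?_
    ext z
    simp
    ring
  · rw [norm_smul, innerSL_apply_norm, norm_mul, norm_neg, Real.norm_eq_abs, Real.abs_exp,
      Real.norm_of_nonneg (by positivity), mul_comm (Real.exp _), mul_assoc]
    exact mul_le_mul_of_nonneg_left
      (exp_neg_norm_add_sq_mul_norm_le (mem_ball_zero_iff.1 hx).le (y : V)) (by positivity)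

theorem summable_exp_neg_norm_add_sq_mul_inner (t u : V) :
    Summable fun y : L => Real.exp (-Real.pi * ‖(y : V) + t‖ ^ 2) * inner ℝ ((y : V) + t) u := by
  refine Summable.of_norm_bounded (((summable_exp_neg_sq_add_linear L
    (2 * Real.pi * ‖t‖ + 1)).mul_left (Real.exp ‖t‖)).mul_right ‖u‖) fun y => ?_
  rw [norm_mul, Real.norm_eq_abs, Real.abs_exp]
  calc _ ≤ Real.exp (-Real.pi * ‖(y : V) + t‖ ^ 2) * (‖(y : V) + t‖ * ‖u‖) :=
        mul_le_mul_of_nonneg_left (norm_inner_le_norm (𝕜 := ℝ) ((y : V) + t) u) (Real.exp_pos _).le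
    _ ≤ _ := by
        rw [← mul_assoc]
        exact mul_le_mul_of_nonneg_right (exp_neg_norm_add_sq_mul_norm_le le_rfl (y : V))
          (norm_nonneg u)

theorem summable_gaussian_mul_exp_abs_inner (u : V) (c : ℝ) :
    Summable fun y : L => Real.exp (-Real.pi * ‖(y : V)‖ ^ 2) *
      Real.exp (c * |inner ℝ (y : V) u|) := by
  refine Summable.of_nonneg_of_le (fun _ => by positivity) (fun y => ?_)
    (summable_exp_neg_sq_add_linear L (|c| * ‖u‖))
  rw [← Real.exp_add, Real.exp_le_exp]
  have h1 : c * |inner ℝ (y : V) u| ≤ |c| * (‖(y : V)‖ * ‖u‖) := by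
    gcongr
    · exact le_abs_self c
    · exact abs_real_inner_le_norm _ _
  linarith

theorem summable_gaussian_mul_cosh (t : V) :
    Summable fun y : L => Real.exp (-Real.pi * ‖(y : V)‖ ^ 2) *
      Real.cosh (2 * Real.pi * inner ℝ (y : V) t) := by
  refine Summable.of_nonneg_of_le (fun _ => by positivity) (fun y => ?_)
    (summable_gaussian_mul_exp_abs_inner L t (2 * Real.pi))
  gcongr
  rw [← Real.cosh_abs, abs_mul, abs_of_nonneg (by positivity : 0 ≤ 2 * Real.pi), Real.cosh_eq]
  have : Real.exp (-(2 * Real.pi * |inner ℝ (y : V) t|)) ≤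
    Real.exp (2 * Real.pi * |inner ℝ (y : V) t|) := Real.exp_le_exp.2 (neg_le_self (by positivity))
  linarith

theorem tsum_gaussian_translate_eq (t : V) :
    ∑' y : L, Real.exp (-Real.pi * ‖(y : V) + t‖ ^ 2) = Real.exp (-Real.pi * ‖t‖ ^ 2) *
      ∑' y : L, Real.exp (-Real.pi * ‖(y : V)‖ ^ 2) *
        Real.cosh (2 * Real.pi * inner ℝ (y : V) t) := by
  have hp := summable_exp_neg_norm_add_sq L t
  have hn : Summable fun y : L => Real.exp (-Real.pi * ‖-(y : V) + t‖ ^ 2) :=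
    (Equiv.neg L).summable_iff.2 hp
  have he : ∑' y : L, Real.exp (-Real.pi * ‖-(y : V) + t‖ ^ 2) =
    ∑' y : L, Real.exp (-Real.pi * ‖(y : V) + t‖ ^ 2) := (Equiv.neg L).tsum_eq
      (fun y : L => Real.exp (-Real.pi * ‖(y : V) + t‖ ^ 2))
  have h2 := hp.tsum_add hn
  rw [he, ← two_mul] at h2
  rw [← tsum_mul_left, ← mul_right_inj' (two_ne_zero (α := ℝ)), ← h2, ← tsum_mul_left]
  refine tsum_congr fun y => ?_
  rw [exp_neg_norm_add_sq, exp_neg_norm_add_sq, norm_neg, inner_neg_left, Real.cosh_eq]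
  ring_nf

theorem tsum_gaussian_translate_mul_inner_eq (t u : V) :
    ∑' y : L, Real.exp (-Real.pi * ‖(y : V) + t‖ ^ 2) * inner ℝ (y : V) u =
      -(Real.exp (-Real.pi * ‖t‖ ^ 2) * ∑' y : L, Real.exp (-Real.pi * ‖(y : V)‖ ^ 2) *
        (Real.sinh (2 * Real.pi * inner ℝ (y : V) t) * inner ℝ (y : V) u)) := by
  have hp : Summable fun y : L => Real.exp (-Real.pi * ‖(y : V) + t‖ ^ 2) * inner ℝ (y : V) u := by
    refine ((summable_exp_neg_norm_add_sq_mul_inner L t u).sub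
      ((summable_exp_neg_norm_add_sq L t).mul_right (inner ℝ t u))).congr fun y => ?_
    rw [inner_add_left]
    ring
  have hn : Summable fun y : L => Real.exp (-Real.pi * ‖-(y : V) + t‖ ^ 2) *
      inner ℝ (-(y : V)) u := (Equiv.neg L).summable_iff.2 hp
  have he : ∑' y : L, Real.exp (-Real.pi * ‖-(y : V) + t‖ ^ 2) * inner ℝ (-(y : V)) u =
    ∑' y : L, Real.exp (-Real.pi * ‖(y : V) + t‖ ^ 2) * inner ℝ (y : V) u := (Equiv.neg L).tsum_eq
      (fun y : L => Real.exp (-Real.pi * ‖(y : V) + t‖ ^ 2) * inner ℝ (y : V) u)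
  have h2 := hp.tsum_add hn
  rw [he, ← two_mul] at h2
  rw [← tsum_mul_left, ← mul_right_inj' (two_ne_zero (α := ℝ)), ← h2, ← tsum_neg, ← tsum_mul_left]
  refine tsum_congr fun y => ?_
  rw [exp_neg_norm_add_sq, exp_neg_norm_add_sq, norm_neg, inner_neg_left, inner_neg_left,
    Real.sinh_eq]
  ring_nf

variable [MeasurableSpace V] [BorelSpace V]

theorem tsum_gaussian_mul_cosh_le (t : V) :
    ∑' y : L, Real.exp (-Real.pi * ‖(y : V)‖ ^ 2) *
        Real.cosh (2 * Real.pi * inner ℝ (y : V) t) ≤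
      Real.exp (Real.pi * ‖t‖ ^ 2) * ∑' y : L, Real.exp (-Real.pi * ‖(y : V)‖ ^ 2) := by
  have h := tsum_gaussian_translate_le L t
  rw [tsum_gaussian_translate_eq] at h
  rwa [neg_mul, Real.exp_neg, inv_mul_le_iff₀ (Real.exp_pos _)] at h

open scoped Classical in
/-- Exponential moments of the one-dimensional marginals over the nonzero lattice vectors. -/
theorem tsum_nonzero_gaussian_mul_exp_le {ε s : ℝ}
    (hL : ∑' y : L, Real.exp (-Real.pi * ‖(y : V)‖ ^ 2) = 1 + ε) (hε : 0 < ε) (hs0 : 0 ≤ s)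
    (hs : Real.exp (Real.pi * s ^ 2) = 2 * (1 + ε) / ε) {u : V} (hu : ‖u‖ = 1) :
    ∑' y : L, (if y = 0 then 0 else Real.exp (-Real.pi * ‖(y : V)‖ ^ 2) *
        Real.exp (2 * Real.pi * s * |inner ℝ (y : V) u|)) ≤
      ε * Real.exp (2 * (Real.pi * s ^ 2)) := by
  have hc := tsum_gaussian_mul_cosh_le L (s • u)
  have hsum := summable_gaussian_mul_cosh L (s • u)
  rw [hL, norm_smul, hu, mul_one, Real.norm_of_nonneg hs0,
    hsum.tsum_eq_add_tsum_ite 0] at hc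
  simp only [ZeroMemClass.coe_zero, norm_zero, inner_zero_left, mul_zero, Real.cosh_zero,
    ne_eq, OfNat.ofNat_ne_zero, not_false_eq_true, zero_pow, Real.exp_zero, mul_one] at hc
  have hle : ∑' y : L, (if y = 0 then 0 else Real.exp (-Real.pi * ‖(y : V)‖ ^ 2) *
        Real.exp (2 * Real.pi * s * |inner ℝ (y : V) u|)) ≤
      2 * ∑' y : L, (if y = 0 then 0 else Real.exp (-Real.pi * ‖(y : V)‖ ^ 2) *
        Real.cosh (2 * Real.pi * inner ℝ (y : V) (s • u))) := by
    rw [← tsum_mul_left]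
    refine Summable.tsum_le_tsum (fun y => ?_) ?_ ?_
    · split_ifs
      · simp
      · rw [← Real.cosh_abs, inner_smul_right, abs_mul (2 * Real.pi), abs_mul s,
          abs_of_nonneg (by positivity : 0 ≤ 2 * Real.pi), abs_of_nonneg hs0, Real.cosh_eq,
          ← mul_assoc (2 * Real.pi) s]
        have := mul_pos (Real.exp_pos (-Real.pi * ‖(y : V)‖ ^ 2))
          (Real.exp_pos (-(2 * Real.pi * s * |inner ℝ (y : V) u|)))
        linarith
    · refine Summable.of_nonneg_of_le (fun y => ?_) (fun y => ?_)
        (summable_gaussian_mul_exp_abs_inner L u (2 * Real.pi * s))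
      · split_ifs <;> positivity
      · split_ifs
        · positivity
        · exact le_rfl
    · refine Summable.mul_left _ (Summable.of_nonneg_of_le (fun y => ?_) (fun y => ?_) hsum)
      · split_ifs <;> positivity
      · split_ifs
        · positivity
        · exact le_rfl
  -- The choice of `s` turns `2(1 + ε)` into `ε e^{πs²}`; the `2` comes from `e^{|x|} ≤ 2 cosh x`.
  have h2 : ε * Real.exp (2 * (Real.pi * s ^ 2)) = 2 * (Real.exp (Real.pi * s ^ 2) * (1 + ε)) := by
    rw [two_mul (Real.pi * s ^ 2), Real.exp_add]
    nth_rw 2 [hs]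
    field_simp
  linarith

end GaussianSums

/-! ### The numerator of the gradient error. -/

section LatticeMoments

variable {V : Type*} [NormedAddCommGroup V] [InnerProductSpace ℝ V] [FiniteDimensional ℝ V]
  [MeasurableSpace V] [BorelSpace V] (L : Submodule ℤ V) [DiscreteTopology L]

open scoped Classical in
theorem tsum_gaussian_mul_sinh_mul_inner_le {ε s δ : ℝ}
    (hL : ∑' y : L, Real.exp (-Real.pi * ‖(y : V)‖ ^ 2) = 1 + ε) (hε : 0 < ε) (hs0 : 0 < s)
    (hs : Real.exp (Real.pi * s ^ 2) = 2 * (1 + ε) / ε) (hs1 : 1 ≤ Real.pi * s ^ 2)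
    (hδ0 : 1 / 8 ≤ δ) (hδ1 : δ ≤ 1 / 2) {t u : V} (ht : ‖t‖ ≤ δ * s) (hu : ‖u‖ = 1) :
    ∑' y : L, Real.exp (-Real.pi * ‖(y : V)‖ ^ 2) *
        (Real.sinh (2 * Real.pi * inner ℝ (y : V) t) * inner ℝ (y : V) u) ≤
      4 * ‖t‖ * Real.exp (2 * δ * (Real.pi * s ^ 2)) * ε := by
  rcases eq_or_ne t 0 with rfl | ht0
  · simp
  have hδp : 0 < δ := by linarith
  set Λ := Real.pi * s ^ 2 with hΛ
  set i := (2 * Λ * (1 - δ))⁻¹ with hi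
  have hi0 : 0 ≤ i := inv_nonneg.2 (by nlinarith)
  have hi1 : i ≤ 1 := inv_le_one_of_one_le₀ (by nlinarith)
  set t' := ‖t‖⁻¹ • t with ht'
  have ht'1 : ‖t'‖ = 1 := by
    rw [ht', norm_smul, norm_inv, norm_norm, inv_mul_cancel₀ (norm_ne_zero_iff.2 ht0)]
  set f : V → L → ℝ := fun x y => if y = 0 then 0 else Real.exp (-Real.pi * ‖(y : V)‖ ^ 2) *
        Real.exp (2 * Real.pi * s * |inner ℝ (y : V) x|) with hf
  set g : L → ℝ := fun y => if y = 0 then 0 else Real.exp (-Real.pi * ‖(y : V)‖ ^ 2) with hg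
  have hfs : ∀ x, Summable (f x) := fun x => by
    refine Summable.of_nonneg_of_le (fun y => ?_) (fun y => ?_)
      (summable_gaussian_mul_exp_abs_inner L x (2 * Real.pi * s))
    · simp only [hf]; split_ifs <;> positivity
    · simp only [hf]; split_ifs
      · positivity
      · exact le_rfl
  have hρ : Summable fun y : L => Real.exp (-Real.pi * ‖(y : V)‖ ^ 2) := by
    simpa using summable_exp_neg_norm_add_sq L 0
  have hgs : Summable g := by
    refine Summable.of_nonneg_of_le (fun y => ?_) (fun y => ?_) hρ
    · simp only [hg]; split_ifs <;> positivity
    · simp only [hg]; split_ifs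
      · positivity
      · exact le_rfl
  have hgsum : ∑' y, g y = ε := by
    rw [hρ.tsum_eq_add_tsum_ite 0] at hL
    simpa [hg] using hL
  set A := ‖t‖ / (2 * δ) * Real.exp (2 * δ * Λ) with hA
  have hA0 : 0 ≤ A := by positivity
  set M : L → ℝ := fun y => A * ((1 - i) * (1 - δ) * g y + δ * Real.exp (-(2 * Λ)) * f t' y +
    i * (1 - δ) * Real.exp (-(2 * Λ)) * f u y) with hM
  have hMs : HasSum M (A * ((1 - i) * (1 - δ) * ε + δ * Real.exp (-(2 * Λ)) * ∑' y, f t' y +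
      i * (1 - δ) * Real.exp (-(2 * Λ)) * ∑' y, f u y)) := by
    have hg' := hgs.hasSum
    rw [hgsum] at hg'
    exact (((hg'.mul_left _).add ((hfs t').hasSum.mul_left _)).add
      ((hfs u).hasSum.mul_left _)).mul_left A
  have hterm : ∀ y : L, Real.exp (-Real.pi * ‖(y : V)‖ ^ 2) *
        (Real.sinh (2 * Real.pi * inner ℝ (y : V) t) * inner ℝ (y : V) u) ≤ M y := fun y => by
    rcases eq_or_ne y 0 with rfl | hy
    · simp [hM, hg, hf]
    have h1 := sinh_mul_inner_le (u := u) (y := (y : V)) hs0 hδp ht0 ht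
    have h2 := mul_exp_le_interpolation (w := |inner ℝ (y : V) u|) (v := |inner ℝ (y : V) t'|)
      hs1 hs0 hδp.le hδ1
    rw [← hΛ, ← hi, sub_eq_add_neg _ (2 * Λ), sub_eq_add_neg _ (2 * Λ), Real.exp_add,
      Real.exp_add] at h2
    have h3 := h1.trans (mul_le_mul_of_nonneg_left h2 (by positivity))
    refine (mul_le_mul_of_nonneg_left h3 (Real.exp_pos _).le).trans_eq ?_
    simp only [hM, hg, hf, hy, if_false, hA]
    field_simp
    ring
  have hfle : ∀ x : V, ‖x‖ = 1 → Real.exp (-(2 * Λ)) * ∑' y, f x y ≤ ε := fun x hx => by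
    have := tsum_nonzero_gaussian_mul_exp_le L hL hε hs0.le hs hx
    rwa [Real.exp_neg, inv_mul_le_iff₀ (Real.exp_pos _), mul_comm _ ε]
  -- The floor `1/8` in `delta` bounds `1 / (2δ)` by `4`.
  have hA4 : A ≤ 4 * ‖t‖ * Real.exp (2 * δ * Λ) := by
    rw [hA]
    gcongr
    rw [div_le_iff₀ (by positivity)]
    nlinarith [norm_nonneg t]
  have hfin : A * ((1 - i) * (1 - δ) * ε + δ * Real.exp (-(2 * Λ)) * ∑' y, f t' y +
      i * (1 - δ) * Real.exp (-(2 * Λ)) * ∑' y, f u y) ≤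
      4 * ‖t‖ * Real.exp (2 * δ * Λ) * ε := by
    have e1 := mul_le_mul_of_nonneg_left (hfle t' ht'1) hδp.le
    have e2 := mul_le_mul_of_nonneg_left (hfle u hu)
      (mul_nonneg hi0 (by linarith : 0 ≤ 1 - δ))
    refine le_trans (mul_le_mul_of_nonneg_left (b := (_ : ℝ)) (c := ε) ?_ hA0)
      (mul_le_mul_of_nonneg_right hA4 hε.le)
    linarith
  -- Without summability `tsum` is `0` and the bound is trivial, so summability need not be proved.
  by_cases hsum : Summable fun y : L => Real.exp (-Real.pi * ‖(y : V)‖ ^ 2) *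
        (Real.sinh (2 * Real.pi * inner ℝ (y : V) t) * inner ℝ (y : V) u)
  · exact (hsum.tsum_le_tsum hterm hMs.summable).trans (hMs.tsum_eq.trans_le hfin)
  · rw [tsum_eq_zero_of_not_summable hsum]
    positivity

end LatticeMoments

/-! ### The periodic Gaussian function and the explicit constants. -/

namespace PeriodicGaussian

variable {n : ℕ} (L : Submodule ℤ (EuclideanSpace ℝ (Fin n)))

theorem rhoSet_lattice : rhoSet (L : Set (EuclideanSpace ℝ (Fin n))) =
    ∑' y : L, Real.exp (-Real.pi * ‖(y : EuclideanSpace ℝ (Fin n))‖ ^ 2) := rfl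

theorem periodicGaussian_eq : periodicGaussian L = fun t =>
    (∑' y : L, Real.exp (-Real.pi * ‖(y : EuclideanSpace ℝ (Fin n)) + t‖ ^ 2)) /
      rhoSet (L : Set (EuclideanSpace ℝ (Fin n))) := by
  ext t
  rw [periodicGaussian]
  congr 1
  exact tsum_image (rho (n := n)) (add_left_injective t).injOn

variable [DiscreteTopology L]

theorem rhoSet_lattice_pos : 0 < rhoSet (L : Set (EuclideanSpace ℝ (Fin n))) := by
  rw [rhoSet_lattice]
  have := summable_exp_neg_norm_add_sq L 0
  simp only [add_zero] at this
  exact this.tsum_pos (fun _ => (Real.exp_pos _).le) 0 (Real.exp_pos _)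

theorem periodicGaussian_pos (t : EuclideanSpace ℝ (Fin n)) : 0 < periodicGaussian L t := by
  rw [periodicGaussian_eq]
  exact div_pos ((summable_exp_neg_norm_add_sq L t).tsum_pos (fun _ => (Real.exp_pos _).le) 0
    (Real.exp_pos _)) (rhoSet_lattice_pos L)

theorem hasFDerivAt_periodicGaussian (t : EuclideanSpace ℝ (Fin n)) :
    HasFDerivAt (periodicGaussian L) ((rhoSet (L : Set (EuclideanSpace ℝ (Fin n))))⁻¹ •
      ∑' y : L, (Real.exp (-Real.pi * ‖(y : EuclideanSpace ℝ (Fin n)) + t‖ ^ 2) *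
        (-(2 * Real.pi))) • innerSL ℝ ((y : EuclideanSpace ℝ (Fin n)) + t)) t := by
  rw [periodicGaussian_eq]
  simp only [div_eq_inv_mul]
  exact (hasFDerivAt_tsum_gaussian L t).const_mul _

theorem rhoSet_le_tsum_gaussian_mul_cosh (t : EuclideanSpace ℝ (Fin n)) :
    rhoSet (L : Set (EuclideanSpace ℝ (Fin n))) ≤
      ∑' y : L, Real.exp (-Real.pi * ‖(y : EuclideanSpace ℝ (Fin n))‖ ^ 2) *
        Real.cosh (2 * Real.pi * inner ℝ (y : EuclideanSpace ℝ (Fin n)) t) := by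
  rw [rhoSet_lattice]
  refine Summable.tsum_le_tsum (fun y => ?_) ?_ (summable_gaussian_mul_cosh L t)
  · exact le_mul_of_one_le_right (Real.exp_pos _).le (Real.one_le_cosh _)
  · simpa using summable_exp_neg_norm_add_sq L 0

theorem inner_gradError (t u : EuclideanSpace ℝ (Fin n)) :
    inner ℝ (gradError L t) u =
      (∑' y : L, Real.exp (-Real.pi * ‖(y : EuclideanSpace ℝ (Fin n))‖ ^ 2) *
        (Real.sinh (2 * Real.pi * inner ℝ (y : EuclideanSpace ℝ (Fin n)) t) *
          inner ℝ (y : EuclideanSpace ℝ (Fin n)) u)) /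
      ∑' y : L, Real.exp (-Real.pi * ‖(y : EuclideanSpace ℝ (Fin n))‖ ^ 2) *
        Real.cosh (2 * Real.pi * inner ℝ (y : EuclideanSpace ℝ (Fin n)) t) := by
  have hS := rhoSet_lattice_pos L
  have hC := hS.trans_le (rhoSet_le_tsum_gaussian_mul_cosh L t)
  have hF := tsum_gaussian_translate_eq L t
  have hN := tsum_gaussian_translate_mul_inner_eq L t u
  have hD := (hasFDerivAt_periodicGaussian L t).fderiv
  set S := rhoSet (L : Set (EuclideanSpace ℝ (Fin n)))
  set C := ∑' y : L, Real.exp (-Real.pi * ‖(y : EuclideanSpace ℝ (Fin n))‖ ^ 2) *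
        Real.cosh (2 * Real.pi * inner ℝ (y : EuclideanSpace ℝ (Fin n)) t)
  set N := ∑' y : L, Real.exp (-Real.pi * ‖(y : EuclideanSpace ℝ (Fin n))‖ ^ 2) *
        (Real.sinh (2 * Real.pi * inner ℝ (y : EuclideanSpace ℝ (Fin n)) t) *
          inner ℝ (y : EuclideanSpace ℝ (Fin n)) u)
  have hderiv : fderiv ℝ (periodicGaussian L) t u = S⁻¹ * (-(2 * Real.pi) *
      (-(Real.exp (-Real.pi * ‖t‖ ^ 2) * N) + Real.exp (-Real.pi * ‖t‖ ^ 2) * C * inner ℝ t u)) := by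
    have hsum : Summable fun y : L =>
        (Real.exp (-Real.pi * ‖(y : EuclideanSpace ℝ (Fin n)) + t‖ ^ 2) *
        (-(2 * Real.pi))) • innerSL ℝ ((y : EuclideanSpace ℝ (Fin n)) + t) := by
      refine Summable.of_norm_bounded (((summable_exp_neg_sq_add_linear L
        (2 * Real.pi * ‖t‖ + 1)).mul_left (Real.exp ‖t‖)).mul_left (2 * Real.pi)) fun y => ?_
      rw [norm_smul, innerSL_apply_norm, norm_mul, norm_neg, Real.norm_eq_abs, Real.abs_exp,
        Real.norm_of_nonneg (by positivity), mul_comm (Real.exp _), mul_assoc]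
      exact mul_le_mul_of_nonneg_left
        (exp_neg_norm_add_sq_mul_norm_le le_rfl (y : EuclideanSpace ℝ (Fin n))) (by positivity)
    have happ := (ContinuousLinearMap.apply ℝ ℝ u).map_tsum hsum
    simp only [ContinuousLinearMap.apply_apply, _root_.smul_apply, innerSL_apply_apply,
      smul_eq_mul] at happ
    rw [hD, _root_.smul_apply, happ, smul_eq_mul, ← hF, ← hN, ← tsum_mul_right,
      ← Summable.tsum_add, ← tsum_mul_left (a := -(2 * Real.pi))]
    · congr 1
      refine tsum_congr fun y => ?_
      rw [inner_add_left]
      ring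
    · refine ((summable_exp_neg_norm_add_sq_mul_inner L t u).sub
        ((summable_exp_neg_norm_add_sq L t).mul_right (inner ℝ t u))).congr fun y => ?_
      rw [inner_add_left]
      ring
    · exact (summable_exp_neg_norm_add_sq L t).mul_right _
  have hval : periodicGaussian L t = Real.exp (-Real.pi * ‖t‖ ^ 2) * C / S := by
    rw [periodicGaussian_eq, ← hF]
  rw [gradError, inner_add_left, real_inner_smul_left, gradient,
    InnerProductSpace.toDual_symm_apply, hderiv, hval]
  have := Real.exp_pos (-Real.pi * ‖t‖ ^ 2)
  have := Real.pi_pos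
  field_simp
  ring

/-- Duality: test `inner_gradError` against the unit vector along the error itself, and use `cosh ≥
1` in the denominator. -/
theorem norm_gradError_le {t : EuclideanSpace ℝ (Fin n)} {B : ℝ} (hB : 0 ≤ B)
    (h : ∀ u : EuclideanSpace ℝ (Fin n), ‖u‖ = 1 →
      ∑' y : L, Real.exp (-Real.pi * ‖(y : EuclideanSpace ℝ (Fin n))‖ ^ 2) *
        (Real.sinh (2 * Real.pi * inner ℝ (y : EuclideanSpace ℝ (Fin n)) t) *
          inner ℝ (y : EuclideanSpace ℝ (Fin n)) u) ≤
        B * rhoSet (L : Set (EuclideanSpace ℝ (Fin n)))) :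
    ‖gradError L t‖ ≤ B := by
  rcases eq_or_ne (gradError L t) 0 with h0 | h0
  · simpa [h0] using hB
  have hn : ‖gradError L t‖ ≠ 0 := norm_ne_zero_iff.2 h0
  have key := inner_gradError L t (‖gradError L t‖⁻¹ • gradError L t)
  rw [real_inner_smul_right, real_inner_self_eq_norm_sq, sq, inv_mul_cancel_left₀ hn] at key
  have hC := rhoSet_le_tsum_gaussian_mul_cosh L t
  rw [key, div_le_iff₀ ((rhoSet_lattice_pos L).trans_le hC)]
  refine (h _ ?_).trans (mul_le_mul_of_nonneg_left hC hB)
  rw [norm_smul, norm_inv, norm_norm, inv_mul_cancel₀ hn]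

theorem pi_mul_sEps_sq {ε : ℝ} (hε0 : 0 < ε) (hε : ε < 1 / 200) :
    Real.pi * sEps ε ^ 2 = Real.log (2 * (1 + ε) / ε) ∧ 1 ≤ Real.pi * sEps ε ^ 2 := by
  have h1 : 1 ≤ Real.log (2 * (1 + ε) / ε) := by
    rw [Real.le_log_iff_exp_le (by positivity)]
    refine Real.exp_one_lt_three.le.trans ?_
    rw [le_div_iff₀ hε0]
    linarith
  have h2 : Real.pi * sEps ε ^ 2 = Real.log (2 * (1 + ε) / ε) := by
    rw [sEps, Real.sq_sqrt (by positivity)]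
    have := Real.pi_ne_zero
    field_simp
  exact ⟨h2, h2 ▸ h1⟩

theorem norm_gradError_le_of_norm_lt {ε : ℝ} (hε0 : 0 < ε) (hε : ε < 1 / 200)
    (hL : rhoSet (L : Set (EuclideanSpace ℝ (Fin n))) = 1 + ε)
    {t : EuclideanSpace ℝ (Fin n)} (ht : ‖t‖ < sEps ε / 2) :
    ‖gradError L t‖ ≤ 8 * (ε / 2) ^ (1 - 2 * delta ε t) * ‖t‖ := by
  obtain ⟨hlog, h1⟩ := pi_mul_sEps_sq hε0 hε
  have hs0 : 0 < sEps ε := by linarith [norm_nonneg t]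
  have hδ0 : 1 / 8 ≤ delta ε t := le_max_left _ _
  have hδ1 : delta ε t ≤ 1 / 2 := max_le (by norm_num) (by rw [div_le_iff₀ hs0]; linarith)
  have htδ : ‖t‖ ≤ delta ε t * sEps ε := (div_le_iff₀ hs0).1 (le_max_right _ _)
  have hexp : Real.exp (Real.pi * sEps ε ^ 2) = 2 * (1 + ε) / ε := by
    rw [hlog, Real.exp_log (by positivity)]
  refine norm_gradError_le L (by positivity) fun u hu => ?_
  refine (tsum_gaussian_mul_sinh_mul_inner_le L hL hε0 hs0 hexp h1 hδ0 hδ1 htδ hu).trans ?_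
  set δ := delta ε t
  have he : Real.exp (2 * δ * (Real.pi * sEps ε ^ 2)) = (ε / 2 / (1 + ε)) ^ (-(2 * δ)) := by
    rw [hlog, Real.rpow_neg (by positivity), ← Real.inv_rpow (by positivity),
      Real.rpow_def_of_pos (by positivity), mul_comm]
    congr 3
    field_simp
  have hle : (ε / 2 / (1 + ε)) ^ (1 - 2 * δ) ≤ (ε / 2) ^ (1 - 2 * δ) :=
    Real.rpow_le_rpow (by positivity) (div_le_self (by positivity) (by linarith)) (by linarith)
  have hsplit : (ε / 2 / (1 + ε)) ^ (1 - 2 * δ) =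
      ε / 2 / (1 + ε) * (ε / 2 / (1 + ε)) ^ (-(2 * δ)) := by
    rw [sub_eq_add_neg, Real.rpow_add (by positivity), Real.rpow_one]
  rw [he, hL]
  -- `4ε = 8 · (ε/2)/(1+ε) · (1+ε)`: hence the constant `8`, sharper than the required `12`.
  calc _ = 8 * (ε / 2 / (1 + ε) * (ε / 2 / (1 + ε)) ^ (-(2 * δ))) * ‖t‖ * (1 + ε) := by
        field_simp; ring
    _ ≤ _ := by rw [← hsplit]; gcongr

/-- `deltaMax` is chosen so that `1 - 2δ ≥ 4/Λ`, while `log(ε/2)` is nearly `-Λ`; the power is thus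
about `e^{-4}` at most. The value `1/32` turns the constant `8` into `1/4`. -/
theorem half_rpow_delta_le {ε : ℝ} (hε0 : 0 < ε) (hε : ε < 1 / 200)
    {t : EuclideanSpace ℝ (Fin n)} (ht : delta ε t ≤ deltaMax ε) :
    (ε / 2) ^ (1 - 2 * delta ε t) ≤ 1 / 32 := by
  obtain ⟨hlog, h1⟩ := pi_mul_sEps_sq hε0 hε
  have hpos : 0 < Real.pi * sEps ε ^ 2 := by linarith
  rw [deltaMax] at ht
  set Λ := Real.pi * sEps ε ^ 2
  have hΛ : 4 / Λ ≤ 1 - 2 * delta ε t := by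
    have : 4 / Λ = 2 * (2 / Λ) := by ring
    linarith
  have hl : Real.log (ε / 2) ≤ 1 / 200 - Λ := by
    have e : 2 * (1 + ε) / ε = (1 + ε) / (ε / 2) := by field_simp
    rw [hlog, e, Real.log_div (x := 1 + ε) (by positivity) (by positivity)]
    have := Real.log_le_sub_one_of_pos (by positivity : 0 < 1 + ε)
    linarith
  calc (ε / 2) ^ (1 - 2 * delta ε t) ≤ (ε / 2) ^ (4 / Λ) :=
        Real.rpow_le_rpow_of_exponent_ge (by positivity) (by linarith) hΛ
    _ = Real.exp (Real.log (ε / 2) * (4 / Λ)) := Real.rpow_def_of_pos (by positivity) _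
    -- As `Λ ≥ 1`, the exponent is at most `-4 + 4/200`.
    _ ≤ Real.exp (-(39 / 10)) := by
        rw [Real.exp_le_exp, ← mul_div_assoc, div_le_iff₀ hpos]
        linarith
    _ ≤ 1 / 32 := by
        have h2 : (2.7 : ℝ) ≤ Real.exp 1 := by linarith [Real.exp_one_gt_d9]
        have h3 : (32 : ℝ) ≤ Real.exp (39 / 10) := by
          have e3 : Real.exp (39 / 10) = Real.exp 1 ^ 3 * Real.exp (9 / 10) := by
            rw [← Real.exp_nat_mul, ← Real.exp_add]; norm_num
          have e4 := Real.add_one_le_exp (9 / 10 : ℝ)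
          have e5 : (2.7 : ℝ) ^ 3 ≤ Real.exp 1 ^ 3 := by gcongr
          rw [e3]
          calc (32 : ℝ) ≤ 2.7 ^ 3 * (9 / 10 + 1) := by norm_num
            _ ≤ _ := by gcongr
        rw [Real.exp_neg, one_div]
        exact inv_anti₀ (by norm_num) h3

end PeriodicGaussian

/-- `L` is a lattice of arbitrary rank, i.e. a discrete additive subgroup of `ℝⁿ` (equivalently,
the integer span of linearly independent vectors). Differentiability and positivity of the periodic
Gaussian function are part of the conclusion, so that `∇f(t) / (2π f(t))` is meaningful. -/
theorem corollary4p3 (n : ℕ) (L : Submodule ℤ (EuclideanSpace ℝ (Fin n))) [DiscreteTopology L]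
    (ε : ℝ) (hε0 : 0 < ε) (hε : ε < 1 / 200)
    (hL : PeriodicGaussian.rhoSet (L : Set (EuclideanSpace ℝ (Fin n))) = 1 + ε) :
    (∀ t : EuclideanSpace ℝ (Fin n),
      0 < PeriodicGaussian.periodicGaussian L t ∧
        DifferentiableAt ℝ (PeriodicGaussian.periodicGaussian L) t) ∧
    (∀ t : EuclideanSpace ℝ (Fin n), ‖t‖ < PeriodicGaussian.sEps ε / 2 →
      ‖PeriodicGaussian.gradError L t‖ ≤
        12 * (ε / 2) ^ (1 - 2 * PeriodicGaussian.delta ε t) * ‖t‖) ∧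
    (∀ t : EuclideanSpace ℝ (Fin n),
      PeriodicGaussian.delta ε t ≤ PeriodicGaussian.deltaMax ε →
      ‖PeriodicGaussian.gradError L t‖ ≤ ‖t‖ / 4) := by
  refine ⟨fun t => ⟨PeriodicGaussian.periodicGaussian_pos L t,
    (PeriodicGaussian.hasFDerivAt_periodicGaussian L t).differentiableAt⟩, fun t ht => ?_,
    fun t ht => ?_⟩
  · refine (PeriodicGaussian.norm_gradError_le_of_norm_lt L hε0 hε hL ht).trans ?_
    gcongr
    norm_num
  · obtain ⟨-, h1⟩ := PeriodicGaussian.pi_mul_sEps_sq hε0 hε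
    have hs0 : 0 < PeriodicGaussian.sEps ε := by
      refine lt_of_le_of_ne (Real.sqrt_nonneg _) fun h0 => ?_
      rw [← h0] at h1
      norm_num at h1
    have hlt : ‖t‖ < PeriodicGaussian.sEps ε / 2 := by
      have h2 : ‖t‖ / PeriodicGaussian.sEps ε ≤ PeriodicGaussian.deltaMax ε :=
        (le_max_right _ _).trans ht
      have h3 : PeriodicGaussian.deltaMax ε < 1 / 2 := sub_lt_self _ (by positivity)
      have := (div_lt_iff₀ hs0).1 (h2.trans_lt h3)
      linarith
    have h4 := mul_le_mul_of_nonneg_right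
      (PeriodicGaussian.half_rpow_delta_le hε0 hε ht) (norm_nonneg t)
    have h5 := PeriodicGaussian.norm_gradError_le_of_norm_lt L hε0 hε hL hlt
    linarith
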